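/- Let $G$ be a finite group, $H$ a normal subgroup of $G$, and let $V=\mathbb{R}^X$ and $Z=\mathbb{R}^Y$ be permutation representations of $G$, where $X,Y$ are finite $G$-sets and $g e_x=e_{gx}$. Let $\sigma:\mathbb{R}\to\mathbb{R}$ be continuous and not a polynomial, acting coordinatewise. Let $W=\mathbb{R}^{G/H}$, with $G$ permuting the cosets by left multiplication, and let $\mathrm{Aff}_G$ denote the space of $G$-equivariant affine maps. Let $\mathcal{U}(V,W,Z)$ be the closure, in the space $\mathcal{C}(V,Z)$ of continuous maps with the topology of uniform convergence on compact sets, of the set of all shallow networks $$v\mapsto \sum_{i=1}^h g_i\bigl(\sigma(f_i(v))\bigr),\qquad h\in\mathbb{N},\ f_i\in \mathrm{Aff}_G(V,W),\ g_i\in\mathrm{Aff}_G(W,Z).$$ Let $\rho$ be the set of pairs $(\alpha,\beta)\in V\times V$ such that $f(\alpha)=f(\beta)$ for all $f\in\mathcal{U}(V,W,Z)$. Then $\mathcal{U}(V,W,Z)$ is separation-constrained universal among continuous equivariant maps, that is, $$\mathcal{U}(V,W,Z)=\{f\in\mathcal{C}(V,Z)\mid f \text{ is } G\text{-equivariant and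 } f(\alpha)=f(\beta)\text{ for all }(\alpha,\beta)\in\rho\}.$$ In particular, if $G$ acts trivially on $Y$ (invariant networks), then $$\mathcal{U}(V,W,Z)=\{f\in\mathcal{C}(V,Z)\mid f(\alpha)=f(\beta)\text{ for all }(\alpha,\beta)\in\rho\}.$$ -/

import Mathlib

namespace EquivNet

/-- The permutation representation of `G` on `ℝ^X`, the real functions on a `G`-set `X`. -/
def permRep (G X : Type*) [Group G] [MulAction G X] : Representation ℝ G (X → ℝ) where
  toFun g :=
    { toFun := fun v x => v (g⁻¹ • x)
      map_add' := fun _ _ => rfl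
      map_smul' := fun _ _ => rfl }
  map_one' := by ext v x; simp
  map_mul' g k := by ext v x; simp [mul_smul]

/-- The defining property `g e_x = e_{g x}` of a permutation representation. -/
theorem permRep_single {G X : Type*} [Group G] [MulAction G X] [DecidableEq X] (g : G) (x : X) :
    permRep G X g (Pi.single x 1) = Pi.single (g • x) 1 := by
  funext y
  change (Pi.single x 1 : X → ℝ) (g⁻¹ • y) = _
  simp only [Pi.single_apply, inv_smul_eq_iff]

/-- `Aff_G(ℝ^X, ℝ^Y)`: the space of `G`-equivariant affine maps. -/
def affEquiv (G X Y : Type*) [Group G] [MulAction G X] [MulAction G Y] :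
    Submodule ℝ ((X → ℝ) →ᵃ[ℝ] (Y → ℝ)) where
  carrier := {f | ∀ (g : G) (v : X → ℝ), f (permRep G X g v) = permRep G Y g (f v)}
  add_mem' := by
    intro a b ha hb g v
    simp [ha g v, hb g v]
  zero_mem' := by
    intro g v
    simp
  smul_mem' := by
    intro c a ha g v
    simp [ha g v]

/-- The point-wise activation `ℝ^X → ℝ^X` attached to `σ : ℝ → ℝ`. -/
def pointwise {X : Type*} (σ : ℝ → ℝ) (v : X → ℝ) : X → ℝ := fun x => σ (v x)

/-- The neural space `N_σ(M, N)` with two layers: all maps `φ ∘ σ ∘ η` with `η ∈ M`, `φ ∈ N`. -/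
def neuralSpace {X Y Z : Type*} (σ : ℝ → ℝ) (M : Set ((X → ℝ) →ᵃ[ℝ] (Y → ℝ)))
    (N : Set ((Y → ℝ) →ᵃ[ℝ] (Z → ℝ))) : Set ((X → ℝ) → (Z → ℝ)) :=
  {F | ∃ η ∈ M, ∃ φ ∈ N, F = fun v => φ (pointwise σ (η v))}

/-- `M_h`: the maps `v ↦ (f_1 v, …, f_h v)` into `W ⊗ ℝ^h`, `W = ℝ^Y`, with all `f_i ∈ M`.
Here `ℝ^Y ⊗ ℝ^h` is `ℝ^(Y × [h])`. -/
def widenOut {X Y : Type*} (M : Submodule ℝ ((X → ℝ) →ᵃ[ℝ] (Y → ℝ))) (h : ℕ) :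
    Set ((X → ℝ) →ᵃ[ℝ] (Y × Fin h → ℝ)) :=
  {F | ∃ f : Fin h → ((X → ℝ) →ᵃ[ℝ] (Y → ℝ)),
    (∀ i, f i ∈ M) ∧ ∀ v y i, F v (y, i) = f i v y}

/-- `_h N`: the maps `(w_1, …, w_h) ↦ g_1 w_1 + ⋯ + g_h w_h` on `W ⊗ ℝ^h`, with all `g_i ∈ N`. -/
def widenIn {Y Z : Type*} (N : Submodule ℝ ((Y → ℝ) →ᵃ[ℝ] (Z → ℝ))) (h : ℕ) :
    Set ((Y × Fin h → ℝ) →ᵃ[ℝ] (Z → ℝ)) :=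
  {F | ∃ g : Fin h → ((Y → ℝ) →ᵃ[ℝ] (Z → ℝ)),
    (∀ i, g i ∈ N) ∧ ∀ w, F w = ∑ i, g i (fun y => w (y, i))}

/-- The universality class `U(M, N)`: the closure of `⋃ h, N_σ(M_h, _h N)` in the space of
continuous maps. The topology of `C(_, _)` is the compact-open one, that is, uniform convergence
on compact sets. -/
def universalityClass {X Y Z : Type*} (σ : ℝ → ℝ)
    (M : Submodule ℝ ((X → ℝ) →ᵃ[ℝ] (Y → ℝ))) (N : Submodule ℝ ((Y → ℝ) →ᵃ[ℝ] (Z → ℝ))) :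
    Set C(X → ℝ, Z → ℝ) :=
  closure {F | ∃ h : ℕ, (F : (X → ℝ) → (Z → ℝ)) ∈ neuralSpace σ (widenOut M h) (widenIn N h)}

/-- `U(ℝ^X, ℝ^Y, ℝ^Z)`: the universality class with all equivariant affine layers. -/
def fullUniversalityClass (G X Y Z : Type*) [Group G] [MulAction G X] [MulAction G Y]
    [MulAction G Z] (σ : ℝ → ℝ) : Set C(X → ℝ, Z → ℝ) :=
  universalityClass σ (affEquiv G X Y) (affEquiv G Y Z)

/-- `C_G(ℝ^X, ℝ^Z)`: the continuous `G`-equivariant maps. -/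
def continuousEquivariant (G X Z : Type*) [Group G] [MulAction G X] [MulAction G Z] :
    Set C(X → ℝ, Z → ℝ) :=
  {f | ∀ (g : G) (v : X → ℝ), f (permRep G X g v) = permRep G Z g (f v)}

/-- The relation `ρ(N)`: the pairs of points that no member of `N` separates. -/
def separationRel {A B : Type*} [TopologicalSpace A] [TopologicalSpace B] (N : Set C(A, B)) :
    Set (A × A) :=
  {p | ∀ f ∈ N, f p.1 = f p.2}

/-- The family `N` is separation-constrained universal within the class `K` of continuous maps:
its closure consists of all maps in `K` that respect the relation `ρ(N)`. -/
def IsSeparationConstrainedUniversal {A B : Type*} [TopologicalSpace A] [TopologicalSpace B]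
    (K N : Set C(A, B)) : Prop :=
  closure N = {f | f ∈ K ∧ ∀ p ∈ separationRel N, f p.1 = f p.2}

end EquivNet

/-!
Let `S` be a closed space of continuous functions on a compact space that contains all ridge
functions `σ (s u + b)` for a fixed `u`. Averaging over `b` shows that `S` contains the ridge
functions of all mollifications `τ` of `σ`, and the `n`-th derivative at `s = 0` shows that
`τ⁽ⁿ⁾(b) uⁿ ∈ S`. For each `n` some `τ⁽ⁿ⁾(b)` is not zero: otherwise all mollifications, and hence
their limit `σ`, would be polynomials of degree less than `n`. So `S` contains the powers of `u` and
thus `exp u`. If `u` ranges over a space of functions that separates points, then these exponentials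
span a subalgebra that separates points, and Stone–Weierstrass gives that `S` is everything.

A normal subgroup `H` acts trivially on `ℝ^(G/H)`, so every network takes the same value at `v` and
at the average of `v` over `H`. Hence an equivariant map `f` that respects `ρ` does not change when
its argument is averaged over `H`, which says that `f` is fixed by the Reynolds operator. That
operator is continuous and sends `v ↦ σ (a v) e_y`, with `a` affine, to a single neuron with
equivariant layers; since these maps span a dense space, `f` is a limit of networks.
-/

namespace EquivNet

section NonPolynomial

open Filter Topology MeasureTheory Polynomial
open scoped Convolution

/-- The real functions given by a polynomial of degree less than `n`, as a space of functions. -/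
noncomputable def polynomialFunctionsLT (n : ℕ) : Submodule ℝ (ℝ → ℝ) :=
  (degreeLT ℝ n).map (LinearMap.pi fun x => leval x)

theorem mem_polynomialFunctionsLT {n : ℕ} {f : ℝ → ℝ} :
    f ∈ polynomialFunctionsLT n ↔ ∃ p ∈ degreeLT ℝ n, ∀ x, f x = p.eval x := by
  simp only [polynomialFunctionsLT, Submodule.mem_map, funext_iff, LinearMap.pi_apply,
    leval_apply, eq_comm]

theorem isClosed_polynomialFunctionsLT (n : ℕ) :
    IsClosed (polynomialFunctionsLT n : Set (ℝ → ℝ)) :=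
  have : FiniteDimensional ℝ (degreeLT ℝ n) := (degreeLTEquiv ℝ n).symm.finiteDimensional
  have : FiniteDimensional ℝ (polynomialFunctionsLT n) := by
    unfold polynomialFunctionsLT; infer_instance
  Submodule.closed_of_finiteDimensional _

theorem mem_polynomialFunctionsLT_of_iteratedDeriv_eq_zero {n : ℕ} {f : ℝ → ℝ}
    (hf : ContDiff ℝ n f) (h : ∀ x, iteratedDeriv n f x = 0) : f ∈ polynomialFunctionsLT n := by
  rw [mem_polynomialFunctionsLT]
  cases n with
  | zero => exact ⟨0, Submodule.zero_mem _, fun x => by simpa using h x⟩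
  | succ n =>
    refine ⟨∑ i ∈ Finset.range (n + 1), monomial i (iteratedDeriv i f 0 / i.factorial),
      Submodule.sum_mem _ fun i hi => mem_degreeLT.2 ?_, fun x => ?_⟩
    · exact (degree_monomial_le i _).trans_lt (by exact_mod_cast Finset.mem_range.1 hi)
    rcases eq_or_ne 0 x with rfl | hx
    · simp [eval_finsetSum, Finset.sum_range_succ']
    obtain ⟨t, -, remainder⟩ :=
      taylor_mean_remainder_lagrange_iteratedDeriv (n := n) hx (mod_cast hf.contDiffOn)
    rw [h t, zero_mul, zero_div, sub_eq_zero] at remainder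
    rw [remainder, taylor_within_apply, eval_finsetSum]
    refine Finset.sum_congr rfl fun i hi => ?_
    have within_eq : iteratedDerivWithin i f (Set.uIcc 0 x) 0 = iteratedDeriv i f 0 :=
      iteratedDerivWithin_eq_iteratedDeriv (uniqueDiffOn_uIcc hx)
        (hf.contDiffAt.of_le (by exact_mod_cast (Finset.mem_range.1 hi).le)) Set.left_mem_uIcc
    rw [within_eq, eval_monomial, sub_zero, smul_eq_mul]
    ring

theorem exists_iteratedDeriv_convolution_ne_zero {σ : ℝ → ℝ} (hσ : Continuous σ)
    (hσ_poly : ¬ ∃ p : ℝ[X], ∀ t, σ t = p.eval t) (n : ℕ) :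
    ∃ (φ : ContDiffBump (0 : ℝ)) (b : ℝ), iteratedDeriv n (φ.normed volume ⋆ σ) b ≠ 0 := by
  by_contra! h
  have mollified_mem (φ : ContDiffBump (0 : ℝ)) :
      φ.normed volume ⋆ σ ∈ polynomialFunctionsLT n :=
    mem_polynomialFunctionsLT_of_iteratedDeriv_eq_zero
      (φ.hasCompactSupport_normed.contDiff_convolution_left _ φ.contDiff_normed
        hσ.locallyIntegrable) (h φ)
  let φ (k : ℕ) : ContDiffBump (0 : ℝ) :=
    ⟨1 / ((k : ℝ) + 1) / 2, 1 / ((k : ℝ) + 1), by positivity, half_lt_self (by positivity)⟩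
  have tendsto_σ : Tendsto (fun k => (φ k).normed volume ⋆ σ) atTop (𝓝 σ) :=
    tendsto_pi_nhds.2 <| ContDiffBump.convolution_tendsto_right_of_continuous
      tendsto_one_div_add_atTop_nhds_zero_nat hσ
  obtain ⟨p, -, hp⟩ := mem_polynomialFunctionsLT.1 <|
    (isClosed_polynomialFunctionsLT n).mem_of_tendsto tendsto_σ <|
      .of_forall fun k => mollified_mem (φ k)
  exact hσ_poly ⟨p, hp⟩

end NonPolynomial

section ClosedSubspaces

open MeasureTheory
open scoped Convolution

theorem integral_mem_of_isClosed {α E : Type*} [MeasurableSpace α] {μ : Measure α}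
    [NormedAddCommGroup E] [NormedSpace ℝ E] [CompleteSpace E] {S : Submodule ℝ E}
    (hS : IsClosed (S : Set E)) {f : α → E} (hf : Integrable f μ) (hmem : ∀ a, f a ∈ S) :
    ∫ a, f a ∂μ ∈ S := by
  have : IsClosed (S : Set E) := hS
  have mk_eq_zero (a : α) : S.mkQL (f a) = 0 := (Submodule.Quotient.mk_eq_zero S).2 (hmem a)
  refine (Submodule.Quotient.mk_eq_zero S).1 (?_ : S.mkQL _ = 0)
  rw [← ContinuousLinearMap.integral_comp_comm _ hf]
  simp only [mk_eq_zero, integral_zero]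

theorem deriv_mem_of_isClosed {E : Type*} [NormedAddCommGroup E] [NormedSpace ℝ E]
    {S : Submodule ℝ E} (hS : IsClosed (S : Set E)) {γ : ℝ → E} (hmem : ∀ s, γ s ∈ S) (s : ℝ) :
    deriv γ s ∈ S := by
  have span_le : Submodule.span ℝ (γ '' Set.univ) ≤ S :=
    Submodule.span_le.2 <| Set.image_subset_iff.2 fun s _ => hmem s
  exact closure_minimal span_le hS
    (range_deriv_subset_closure_span_image γ dense_univ ⟨s, rfl⟩)

variable {K : Type*} [TopologicalSpace K]

/-- The ridge function `x ↦ σ (u x + b)`, that is, a single neuron with input `u` and bias `b`. -/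
def ridge (σ : C(ℝ, ℝ)) (u : C(K, ℝ)) (b : ℝ) : C(K, ℝ) :=
  σ.comp (u + .const K b)

@[simp]
theorem ridge_apply (σ : C(ℝ, ℝ)) (u : C(K, ℝ)) (b : ℝ) (x : K) :
    ridge σ u b x = σ (u x + b) :=
  rfl

theorem continuous_ridge (σ : C(ℝ, ℝ)) :
    Continuous fun p : C(K, ℝ) × ℝ => ridge σ p.1 p.2 :=
  (ContinuousMap.continuous_postcomp σ).comp <|
    continuous_fst.add (ContinuousMap.continuous_const'.comp continuous_snd)

variable [CompactSpace K]

theorem hasDerivAt_of_hasDerivAt_apply {γ γ' : ℝ → C(K, ℝ)} (hγ' : Continuous γ')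
    (h : ∀ s x, HasDerivAt (fun s => γ s x) (γ' s x) s) (s : ℝ) : HasDerivAt γ (γ' s) s := by
  have eq_integral (s : ℝ) : γ s = γ 0 + ∫ t in (0 : ℝ)..s, γ' t := by
    ext x
    have eval_integral := (ContinuousMap.evalCLM ℝ x).intervalIntegral_comp_comm
      (hγ'.intervalIntegrable (μ := volume) 0 s)
    have ftc := intervalIntegral.integral_eq_sub_of_hasDerivAt (fun t _ => h t x)
      (((continuous_eval_const x).comp hγ').intervalIntegrable 0 s)
    simp only [ContinuousMap.evalCLM_apply] at eval_integral
    rw [ContinuousMap.add_apply, ← eval_integral, ftc, add_sub_cancel]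
  rw [funext eq_integral]
  exact (intervalIntegral.integral_hasDerivAt_right (hγ'.intervalIntegrable _ _)
    (hγ'.stronglyMeasurableAtFilter _ _) hγ'.continuousAt).const_add _

variable {S : Submodule ℝ C(K, ℝ)} (hS : IsClosed (S : Set C(K, ℝ)))
include hS

theorem ridge_convolution_mem {σ τ : C(ℝ, ℝ)} {φ : ℝ → ℝ} (hφ : Continuous φ)
    (hφ' : HasCompactSupport φ) (hτ : ⇑τ = φ ⋆ σ) {u : C(K, ℝ)} (h : ∀ b, ridge σ u b ∈ S)
    (b : ℝ) : ridge τ u b ∈ S := by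
  have integrable : Integrable fun t => φ t • ridge σ u (b - t) :=
    (hφ.smul <| (continuous_ridge σ).comp (by fun_prop : Continuous fun t => (u, b - t)))
      |>.integrable_of_hasCompactSupport hφ'.smul_right
  have eq_integral : ridge τ u b = ∫ t, φ t • ridge σ u (b - t) := by
    ext x
    rw [ContinuousMap.integral_apply integrable, ridge_apply, hτ]
    simp [convolution_def, add_sub_assoc]
  rw [eq_integral]
  exact integral_mem_of_isClosed hS integrable fun t => S.smul_mem _ (h _)

theorem mul_ridge_deriv_mem {τ τ' : C(ℝ, ℝ)} (hτ : ∀ t, HasDerivAt τ (τ' t) t) {w u : C(K, ℝ)}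
    {b : ℝ} (h : ∀ s : ℝ, w * ridge τ (s • u) b ∈ S) (s : ℝ) :
    w * u * ridge τ' (s • u) b ∈ S := by
  have continuous_deriv : Continuous fun s : ℝ => w * u * ridge τ' (s • u) b :=
    continuous_const.mul <| (continuous_ridge τ').comp
      (by fun_prop : Continuous fun s : ℝ => (s • u, b))
  have hasDerivAt_apply (s : ℝ) (x : K) :
      HasDerivAt (fun s => (w * ridge τ (s • u) b) x) ((w * u * ridge τ' (s • u) b) x) s := by
    have inner : HasDerivAt (fun s => s * u x + b) (u x) s :=
      (hasDerivAt_mul_const (u x)).add_const b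
    refine (((hτ (s * u x + b)).comp s inner).const_mul (w x)).congr_deriv ?_
    simp only [ContinuousMap.mul_apply, ridge_apply, ContinuousMap.smul_apply, smul_eq_mul]
    ring
  rw [← (hasDerivAt_of_hasDerivAt_apply continuous_deriv hasDerivAt_apply s).deriv]
  exact deriv_mem_of_isClosed hS h s

theorem iteratedDeriv_smul_mul_pow_mem {n : ℕ} {τ : C(ℝ, ℝ)} (hτ : ContDiff ℝ n τ)
    {w u : C(K, ℝ)} {b : ℝ} (h : ∀ s : ℝ, w * ridge τ (s • u) b ∈ S) :
    iteratedDeriv n τ b • (w * u ^ n) ∈ S := by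
  induction n generalizing τ w with
  | zero =>
    convert h 0 using 1
    ext x
    simp [mul_comm]
  | succ n ih =>
    have hτ' : ContDiff ℝ n (deriv τ) :=
      ((contDiff_succ_iff_deriv (n := n)).1 (by exact_mod_cast hτ)).2.2
    have hasDerivAt (t : ℝ) : HasDerivAt τ (deriv τ t) t :=
      (hτ.differentiable (by simp) t).hasDerivAt
    rw [iteratedDeriv_succ', pow_succ', ← mul_assoc]
    exact ih (τ := ⟨deriv τ, hτ'.continuous⟩) hτ' (mul_ridge_deriv_mem hS hasDerivAt h)

theorem pow_mem_of_ridge_mem {σ : C(ℝ, ℝ)} (hσ_poly : ¬ ∃ p : Polynomial ℝ, ∀ t, σ t = p.eval t)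
    {u : C(K, ℝ)} (h : ∀ s b : ℝ, ridge σ (s • u) b ∈ S) (n : ℕ) : u ^ n ∈ S := by
  obtain ⟨φ, b, hb⟩ := exists_iteratedDeriv_convolution_ne_zero σ.continuous hσ_poly n
  have contDiff : ContDiff ℝ n (φ.normed volume ⋆ σ) :=
    φ.hasCompactSupport_normed.contDiff_convolution_left _ φ.contDiff_normed
      σ.continuous.locallyIntegrable
  let τ : C(ℝ, ℝ) := ⟨φ.normed volume ⋆ σ, contDiff.continuous⟩
  have ridge_τ_mem (s : ℝ) : 1 * ridge τ (s • u) b ∈ S := by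
    rw [one_mul]
    exact ridge_convolution_mem hS φ.continuous_normed φ.hasCompactSupport_normed rfl (h s) b
  simpa [τ] using (S.smul_mem_iff hb).1 (iteratedDeriv_smul_mul_pow_mem hS contDiff ridge_τ_mem)

theorem exp_mem_of_pow_mem {u : C(K, ℝ)} (h : ∀ n, u ^ n ∈ S) : NormedSpace.exp u ∈ S :=
  hS.mem_of_tendsto (NormedSpace.exp_series_hasSum_exp' (𝕂 := ℝ) u) <|
    .of_forall fun _ => S.sum_mem fun n _ => S.smul_mem _ (h n)

theorem eq_top_of_exp_mem {A : AddSubmonoid C(K, ℝ)}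
    (hA : Set.SeparatesPoints ((⇑) '' (A : Set C(K, ℝ)))) (h : ∀ u ∈ A, NormedSpace.exp u ∈ S) :
    S = ⊤ := by
  let exponentials : Submonoid C(K, ℝ) :=
    { carrier := NormedSpace.exp '' A
      one_mem' := ⟨0, A.zero_mem, NormedSpace.exp_zero⟩
      mul_mem' := by
        rintro _ _ ⟨u, hu, rfl⟩ ⟨w, hw, rfl⟩
        exact ⟨u + w, A.add_mem hu hw, NormedSpace.exp_add⟩ }
  have adjoin_le : Subalgebra.toSubmodule (Algebra.adjoin ℝ (exponentials : Set C(K, ℝ))) ≤ S := by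
    rw [Algebra.adjoin_eq_span, Submonoid.closure_eq, Submodule.span_le]
    exact Set.image_subset_iff.2 h
  have dense := ContinuousMap.subalgebra_topologicalClosure_eq_top_of_separatesPoints
    (Algebra.adjoin ℝ (exponentials : Set C(K, ℝ))) <| by
      intro x y hxy
      obtain ⟨_, ⟨u, hu, rfl⟩, u_ne⟩ := hA hxy
      refine ⟨_, ⟨NormedSpace.exp u, Algebra.subset_adjoin ⟨u, hu, rfl⟩, rfl⟩, ?_⟩
      simpa [NormedSpace.exp_continuousMap_eq, ← Real.exp_eq_exp_ℝ] using u_ne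
  refine eq_top_iff.2 fun f _ => closure_minimal adjoin_le hS ?_
  change f ∈ (Algebra.adjoin ℝ (exponentials : Set C(K, ℝ))).topologicalClosure
  exact dense ▸ Algebra.mem_top

theorem eq_top_of_ridge_mem_of_compactSpace {σ : C(ℝ, ℝ)}
    (hσ_poly : ¬ ∃ p : Polynomial ℝ, ∀ t, σ t = p.eval t) {A : Submodule ℝ C(K, ℝ)}
    (hA : Set.SeparatesPoints ((⇑) '' (A : Set C(K, ℝ)))) (h : ∀ u ∈ A, ∀ b, ridge σ u b ∈ S) :
    S = ⊤ :=
  eq_top_of_exp_mem (A := A.toAddSubmonoid) hS hA fun _ hu => exp_mem_of_pow_mem hS <|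
    pow_mem_of_ridge_mem hS hσ_poly fun s => h _ (A.smul_mem s hu)

end ClosedSubspaces

section CompactConvergence

variable {V : Type*} [TopologicalSpace V]

theorem eq_top_of_forall_dense_restrict {S : Submodule ℝ C(V, ℝ)}
    (hS : IsClosed (S : Set C(V, ℝ)))
    (h : ∀ K : Set V, IsCompact K → Dense (ContinuousMap.restrict K '' (S : Set C(V, ℝ)))) :
    S = ⊤ := by
  refine eq_top_iff.2 fun f _ => hS.closure_subset ?_
  rw [mem_closure_iff_nhds_basis
    (nhds_basis_uniformity Metric.uniformity_basis_dist.compactConvergenceUniformity)]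
  rintro ⟨K, ε⟩ ⟨hK, hε⟩
  have := isCompact_iff_compactSpace.1 hK
  obtain ⟨_, ⟨g, hg, rfl⟩, dist_lt⟩ := Metric.mem_closure_iff.1 (h K hK (f.restrict K)) ε hε
  rw [dist_comm, ContinuousMap.dist_lt_iff hε] at dist_lt
  exact ⟨g, hg, fun x hx => dist_lt ⟨x, hx⟩⟩

theorem eq_top_of_ridge_mem {S : Submodule ℝ C(V, ℝ)} (hS : IsClosed (S : Set C(V, ℝ)))
    {σ : C(ℝ, ℝ)} (hσ_poly : ¬ ∃ p : Polynomial ℝ, ∀ t, σ t = p.eval t) {A : Submodule ℝ C(V, ℝ)}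
    (hA : Set.SeparatesPoints ((⇑) '' (A : Set C(V, ℝ)))) (h : ∀ u ∈ A, ∀ b, ridge σ u b ∈ S) :
    S = ⊤ := by
  refine eq_top_of_forall_dense_restrict hS fun K hK => ?_
  have := isCompact_iff_compactSpace.1 hK
  let restrictₗ : C(V, ℝ) →ₗ[ℝ] C(K, ℝ) :=
    { toFun := ContinuousMap.restrict K
      map_add' := fun _ _ => rfl
      map_smul' := fun _ _ => rfl }
  change Dense (S.map restrictₗ : Set C(K, ℝ))
  rw [Submodule.dense_iff_topologicalClosure_eq_top]
  refine eq_top_of_ridge_mem_of_compactSpace (A := A.map restrictₗ)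
    (Submodule.isClosed_topologicalClosure _) hσ_poly ?_ ?_
  · intro x y hxy
    obtain ⟨_, ⟨u, hu, rfl⟩, u_ne⟩ := hA (Subtype.coe_injective.ne hxy)
    exact ⟨_, ⟨restrictₗ u, Submodule.mem_map_of_mem hu, rfl⟩, u_ne⟩
  · rintro _ ⟨u, hu, rfl⟩ b
    exact Submodule.le_topologicalClosure _ (Submodule.mem_map_of_mem (h u hu b))

variable {Y : Type*} [DecidableEq Y]

/-- The map `v ↦ w v • e_y`, as a continuous linear function of `w`. -/
noncomputable def singleCoord (V : Type*) [TopologicalSpace V] (y : Y) :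
    C(V, ℝ) →L[ℝ] C(V, Y → ℝ) :=
  (ContinuousLinearMap.single ℝ (fun _ : Y => ℝ) y).compLeftContinuous ℝ V

@[simp]
theorem singleCoord_apply (y : Y) (w : C(V, ℝ)) (v : V) :
    singleCoord V y w v = Pi.single y (w v) :=
  rfl

open Filter Topology in
theorem hasSum_singleCoord (f : C(V, Y → ℝ)) :
    HasSum (fun y => singleCoord V y ((ContinuousMap.eval y).comp f)) f := by
  rw [HasSum, SummationFilter.unconditional_filter,
    ContinuousMap.tendsto_iff_forall_isCompact_tendstoUniformlyOn]
  intro K _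
  rw [tendstoUniformlyOn_iff_tendsto, Pi.uniformity, tendsto_iInf]
  intro y
  rw [tendsto_comap_iff]
  intro U hU
  rw [mem_map]
  filter_upwards [(eventually_ge_atTop {y}).prod_inl (𝓟 K)] with ⟨s, v⟩ hs
  refine mem_uniformity_of_eq hU ?_
  simp [ContinuousMap.sum_apply, Pi.single_apply, Finset.singleton_subset_iff.1 hs]

theorem eq_top_of_singleCoord_ridge_mem {S : Submodule ℝ C(V, Y → ℝ)}
    (hS : IsClosed (S : Set C(V, Y → ℝ))) {σ : C(ℝ, ℝ)}
    (hσ_poly : ¬ ∃ p : Polynomial ℝ, ∀ t, σ t = p.eval t) {A : Submodule ℝ C(V, ℝ)}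
    (hA : Set.SeparatesPoints ((⇑) '' (A : Set C(V, ℝ))))
    (h : ∀ y, ∀ u ∈ A, ∀ b, singleCoord V y (ridge σ u b) ∈ S) : S = ⊤ := by
  refine eq_top_iff.2 fun f _ => ?_
  have comap_eq_top (y : Y) : S.comap (singleCoord V y).toLinearMap = ⊤ :=
    eq_top_of_ridge_mem (hS.preimage (singleCoord V y).continuous) hσ_poly hA (h y)
  refine hS.mem_of_tendsto (hasSum_singleCoord f) <| .of_forall fun _ => S.sum_mem fun y _ => ?_
  exact (comap_eq_top y).ge (Submodule.mem_top (x := (ContinuousMap.eval y).comp f))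

end CompactConvergence

section Networks

variable {X Y Z : Type*}

theorem affineMap_sum_apply {ι k V P W : Type*} [Ring k] [AddCommGroup V] [Module k V]
    [AddTorsor V P] [AddCommGroup W] [Module k W] (s : Finset ι) (f : ι → P →ᵃ[k] W) (p : P) :
    (∑ i ∈ s, f i) p = ∑ i ∈ s, f i p :=
  map_sum (⟨⟨fun f => f p, rfl⟩, fun _ _ => rfl⟩ : (P →ᵃ[k] W) →+ W) f s

theorem mem_neuralSpace_iff {σ : ℝ → ℝ} {M : Submodule ℝ ((X → ℝ) →ᵃ[ℝ] (Y → ℝ))}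
    {N : Submodule ℝ ((Y → ℝ) →ᵃ[ℝ] (Z → ℝ))} {h : ℕ} {F : (X → ℝ) → (Z → ℝ)} :
    F ∈ neuralSpace σ (widenOut M h) (widenIn N h) ↔
      ∃ (f : Fin h → ((X → ℝ) →ᵃ[ℝ] (Y → ℝ))) (g : Fin h → ((Y → ℝ) →ᵃ[ℝ] (Z → ℝ))),
        (∀ i, f i ∈ M) ∧ (∀ i, g i ∈ N) ∧ F = ∑ i, fun v => g i (pointwise σ (f i v)) := by
  constructor
  · rintro ⟨η, ⟨f, hf, hη⟩, φ, ⟨g, hg, hφ⟩, rfl⟩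
    refine ⟨f, g, hf, hg, funext fun v => ?_⟩
    simp only [hφ, pointwise, hη, Finset.sum_apply]
    rfl
  · rintro ⟨f, g, hf, hg, rfl⟩
    refine ⟨AffineMap.pi fun p => (AffineMap.proj p.1).comp (f p.2), ⟨f, hf, fun _ _ _ => rfl⟩,
      ∑ i, (g i).comp (LinearMap.funLeft ℝ ℝ fun y => (y, i)).toAffineMap,
      ⟨g, hg, fun w => ?_⟩, funext fun v => ?_⟩
    · simp only [affineMap_sum_apply]
      rfl
    · simp only [affineMap_sum_apply, Finset.sum_apply]
      rfl

/-- The continuous shallow networks with inner layers in `M` and outer layers in `N`, as a linear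
space: the finite sums of maps `v ↦ g (σ (f v))`. The single summands need not be continuous, since
`ℝ^X` may have infinite dimension. -/
def networks (σ : ℝ → ℝ) (M : Submodule ℝ ((X → ℝ) →ᵃ[ℝ] (Y → ℝ)))
    (N : Submodule ℝ ((Y → ℝ) →ᵃ[ℝ] (Z → ℝ))) : Submodule ℝ C(X → ℝ, Z → ℝ) :=
  (Submodule.span ℝ {F | ∃ f ∈ M, ∃ g ∈ N, F = fun v => g (pointwise σ (f v))}).comap
    (ContinuousMap.coeFnLinearMap ℝ)

theorem mem_networks {σ : ℝ → ℝ} {M : Submodule ℝ ((X → ℝ) →ᵃ[ℝ] (Y → ℝ))}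
    {N : Submodule ℝ ((Y → ℝ) →ᵃ[ℝ] (Z → ℝ))} {F : C(X → ℝ, Z → ℝ)} :
    F ∈ networks σ M N ↔ ∃ h, ⇑F ∈ neuralSpace σ (widenOut M h) (widenIn N h) := by
  simp only [mem_neuralSpace_iff]
  constructor
  · intro hF
    obtain ⟨h, c, G, hG⟩ := (Submodule.mem_span_set' (R := ℝ)).1 hF
    choose f hf g hg hfg using fun i => (G i).2
    refine ⟨h, f, fun i => c i • g i, hf, fun i => N.smul_mem _ (hg i), ?_⟩
    change ContinuousMap.coeFnLinearMap ℝ F = _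
    rw [← hG]
    simp only [hfg]
    rfl
  · rintro ⟨h, f, g, hf, hg, hF⟩
    change ⇑F ∈ Submodule.span ℝ _
    exact hF ▸ Submodule.sum_mem _ fun i _ => Submodule.subset_span ⟨f i, hf i, g i, hg i, rfl⟩

theorem universalityClass_eq_closure_networks (σ : ℝ → ℝ)
    (M : Submodule ℝ ((X → ℝ) →ᵃ[ℝ] (Y → ℝ))) (N : Submodule ℝ ((Y → ℝ) →ᵃ[ℝ] (Z → ℝ))) :
    universalityClass σ M N = closure (networks σ M N : Set C(X → ℝ, Z → ℝ)) :=
  congrArg closure <| Set.ext fun _ => mem_networks.symm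

theorem apply_eq_of_mem_universalityClass {σ : ℝ → ℝ} {M : Submodule ℝ ((X → ℝ) →ᵃ[ℝ] (Y → ℝ))}
    {N : Submodule ℝ ((Y → ℝ) →ᵃ[ℝ] (Z → ℝ))} {T : (Z → ℝ) →L[ℝ] (Z → ℝ)} {v w : X → ℝ}
    (h : ∀ f ∈ M, ∀ g ∈ N, g (pointwise σ (f w)) = T (g (pointwise σ (f v))))
    {F : C(X → ℝ, Z → ℝ)} (hF : F ∈ universalityClass σ M N) : F w = T (F v) := by
  rw [universalityClass_eq_closure_networks] at hF
  refine closure_minimal (t := {F : C(X → ℝ, Z → ℝ) | F w = T (F v)}) (fun F hF => ?_)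
    (isClosed_eq (continuous_eval_const w) (T.continuous.comp (continuous_eval_const v))) hF
  refine LinearMap.eqOn_span (f := LinearMap.proj w) (g := T.toLinearMap ∘ₗ LinearMap.proj v)
    ?_ hF
  rintro _ ⟨f, hf, g, hg, rfl⟩
  exact h f hf g hg

end Networks

/-- The space of continuous affine functions on `ℝ^X`. -/
def affineFunctions (X : Type*) : Submodule ℝ C(X → ℝ, ℝ) where
  carrier := {u | ∃ a : (X → ℝ) →ᵃ[ℝ] ℝ, ⇑u = a}
  zero_mem' := ⟨0, rfl⟩
  add_mem' := by
    rintro u w ⟨a, ha⟩ ⟨b, hb⟩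
    exact ⟨a + b, congrArg₂ (· + ·) ha hb⟩
  smul_mem' := by
    rintro c u ⟨a, ha⟩
    exact ⟨c • a, congrArg (c • ·) ha⟩

theorem separatesPoints_affineFunctions (X : Type*) :
    Set.SeparatesPoints ((⇑) '' (affineFunctions X : Set C(X → ℝ, ℝ))) := fun _ _ hvw =>
  (Function.ne_iff.1 hvw).imp' (fun x => ⇑(ContinuousMap.eval x : C(X → ℝ, ℝ))) fun x hx =>
    ⟨⟨_, ⟨AffineMap.proj x, rfl⟩, rfl⟩, hx⟩

section Equivariant

variable {G X Y Z : Type*} [Group G] [MulAction G X] [MulAction G Y] [MulAction G Z]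

theorem permRep_permRep (g k : G) (v : X → ℝ) :
    permRep G X g (permRep G X k v) = permRep G X (g * k) v :=
  (LinearMap.congr_fun (map_mul (permRep G X) g k) v).symm

theorem continuous_permRep (g : G) : Continuous (permRep G X g) :=
  continuous_pi fun x => continuous_apply (g⁻¹ • x)

theorem permRep_eq_one {g : G} (h : ∀ x : X, g • x = x) : permRep G X g = 1 :=
  LinearMap.ext fun v => funext fun x => congrArg v (inv_smul_eq_iff.2 (h x).symm)

theorem permRep_quotient_eq_one {H : Subgroup G} [H.Normal] {h : G} (hh : h ∈ H) :
    permRep G (G ⧸ H) h = 1 := by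
  refine permRep_eq_one fun c => ?_
  induction c using QuotientGroup.induction_on with
  | H k =>
    change ((h * k : G) : G ⧸ H) = k
    rw [QuotientGroup.mk_mul, (QuotientGroup.eq_one_iff h).2 hh, one_mul]

theorem fullUniversalityClass_subset_continuousEquivariant (σ : ℝ → ℝ) :
    fullUniversalityClass G X Y Z σ ⊆ continuousEquivariant G X Z := fun _ hF k v =>
  apply_eq_of_mem_universalityClass (T := ⟨permRep G Z k, continuous_permRep k⟩)
    (fun f hf g hg => by rw [hf k v]; exact hg k (pointwise σ (f v))) hF

theorem mem_continuousEquivariant_of_smul_eq {N : Set C(X → ℝ, Y → ℝ)}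
    (hN : N ⊆ continuousEquivariant G X Y) (htriv : ∀ (g : G) (y : Y), g • y = y)
    {f : C(X → ℝ, Y → ℝ)} (hf : ∀ p ∈ separationRel N, f p.1 = f p.2) :
    f ∈ continuousEquivariant G X Y := fun g v => by
  have permRep_mem : (permRep G X g v, v) ∈ separationRel N := fun F hF => by
    rw [hN hF g v, permRep_eq_one (htriv g), Module.End.one_apply]
  rw [hf _ permRep_mem, permRep_eq_one (htriv g), Module.End.one_apply]

/-- The average of a vector over the subgroup `H`. -/
noncomputable def average (X : Type*) [MulAction G X] (H : Subgroup G) [Fintype H] :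
    (X → ℝ) →ₗ[ℝ] (X → ℝ) :=
  (Fintype.card H : ℝ)⁻¹ • ∑ h : H, permRep G X h

section Average

variable (H : Subgroup G) [Fintype H]

theorem average_apply (v : X → ℝ) :
    average X H v = (Fintype.card H : ℝ)⁻¹ • ∑ h : H, permRep G X h v := by
  simp [average]

theorem continuous_average : Continuous (average X H) := by
  rw [funext (average_apply (X := X) H)]
  exact (continuous_finsetSum _ fun h _ => continuous_permRep (X := X) h.1).fun_const_smul _

variable {H} in
theorem average_permRep_of_mem {h : G} (hh : h ∈ H) (v : X → ℝ) :
    average X H (permRep G X h v) = average X H v := by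
  rw [average_apply, average_apply]
  congr 1
  exact Fintype.sum_equiv (Equiv.mulRight ⟨h, hh⟩) _ _ fun k => permRep_permRep _ _ v

theorem affineMap_average {W : Type*} [AddCommGroup W] [Module ℝ W] {f : (X → ℝ) →ᵃ[ℝ] W}
    (hf : ∀ h ∈ H, ∀ v, f (permRep G X h v) = f v) (v : X → ℝ) : f (average X H v) = f v := by
  have linear_permRep (h : H) : f.linear (permRep G X h v) = f.linear v := by
    have map_eq := hf h h.2 v
    rw [f.decomp] at map_eq
    exact add_right_cancel map_eq
  rw [f.decomp]
  simp [average_apply, linear_permRep, ← Nat.cast_smul_eq_nsmul ℝ, smul_smul]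

theorem fullUniversalityClass_average [H.Normal] {σ : ℝ → ℝ} {F : C(X → ℝ, Z → ℝ)}
    (hF : F ∈ fullUniversalityClass G X (G ⧸ H) Z σ) (v : X → ℝ) : F (average X H v) = F v := by
  refine apply_eq_of_mem_universalityClass (T := .id ℝ _) (fun f hf g _ => ?_) hF
  rw [affineMap_average H (fun h hh w => ?_) v, ContinuousLinearMap.id_apply]
  rw [hf h w, permRep_quotient_eq_one hh, Module.End.one_apply]

/-- The average of `g⁻¹ v` over the subgroup `H`, which depends only on the coset `c = g H`. -/
noncomputable def cosetAverage (c : G ⧸ H) : (X → ℝ) →ₗ[ℝ] (X → ℝ) :=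
  Quotient.liftOn' c (fun g => average X H ∘ₗ permRep G X g⁻¹) fun g k h => by
    ext1 v
    simpa only [LinearMap.comp_apply, permRep_permRep, mul_inv_cancel_right] using
      average_permRep_of_mem (QuotientGroup.leftRel_apply.1 h) (permRep G X k⁻¹ v)

theorem cosetAverage_mk (g : G) (v : X → ℝ) :
    cosetAverage H g v = average X H (permRep G X g⁻¹ v) :=
  rfl

theorem continuous_cosetAverage (c : G ⧸ H) : Continuous (cosetAverage (X := X) H c) := by
  induction c using QuotientGroup.induction_on with
  | H g => exact (continuous_average H).comp (continuous_permRep g⁻¹)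

theorem cosetAverage_permRep (k : G) (c : G ⧸ H) (v : X → ℝ) :
    cosetAverage H c (permRep G X k v) = cosetAverage H (k⁻¹ • c) v := by
  induction c using QuotientGroup.induction_on with
  | H g =>
    change _ = cosetAverage H ((k⁻¹ * g : G) : G ⧸ H) v
    simp only [cosetAverage_mk, permRep_permRep, mul_inv_rev, inv_inv]

/-- The equivariant affine map `ℝ^X → ℝ^(G/H)` obtained from an affine function `a` on `ℝ^X`. -/
noncomputable def cosetLayer (a : (X → ℝ) →ᵃ[ℝ] ℝ) : (X → ℝ) →ᵃ[ℝ] (G ⧸ H → ℝ) :=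
  AffineMap.pi fun c => a.comp (cosetAverage H c).toAffineMap

theorem cosetLayer_apply (a : (X → ℝ) →ᵃ[ℝ] ℝ) (v : X → ℝ) (c : G ⧸ H) :
    cosetLayer H a v c = a (cosetAverage H c v) :=
  rfl

theorem cosetLayer_mem (a : (X → ℝ) →ᵃ[ℝ] ℝ) : cosetLayer H a ∈ affEquiv G X (G ⧸ H) :=
  fun k v => funext fun c => congrArg a (cosetAverage_permRep H k c v)

end Average

variable [Fintype G] (H : Subgroup G)

section CosetLift

variable [DecidableEq Y]

/-- The equivariant linear map `ℝ^(G/H) → ℝ^Y` that sends `e_(gH)` to the sum of the `e_(g h y)`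
with `h ∈ H`. -/
noncomputable def cosetLift (y : Y) : (G ⧸ H → ℝ) →ₗ[ℝ] (Y → ℝ) :=
  ∑ g : G, (LinearMap.proj (g : G ⧸ H)).smulRight (Pi.single (g • y) 1)

theorem cosetLift_apply (y : Y) (w : G ⧸ H → ℝ) :
    cosetLift H y w = ∑ g : G, w g • (Pi.single (g • y) 1 : Y → ℝ) := by
  simp [cosetLift]

theorem cosetLift_mem (y : Y) : (cosetLift H y).toAffineMap ∈ affEquiv G (G ⧸ H) Y := by
  intro k w
  simp only [LinearMap.coe_toAffineMap, cosetLift_apply, map_sum, map_smul, permRep_single]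
  refine (Fintype.sum_equiv (Equiv.mulLeft k) _ _ fun g => ?_).symm
  have coset_eq : k⁻¹ • ((k * g : G) : G ⧸ H) = g :=
    congrArg QuotientGroup.mk (inv_mul_cancel_left k g)
  change _ = w (k⁻¹ • ((k * g : G) : G ⧸ H)) • (Pi.single ((k * g) • y) 1 : Y → ℝ)
  rw [coset_eq, mul_smul]

end CosetLift

section Reynolds

variable [Fintype H]

/-- The Reynolds operator: it averages the conjugates `v ↦ g (f (g⁻¹ v))` of a map `f` over `G`,
after averaging the argument of `f` over the subgroup `H`. -/
noncomputable def reynolds : C(X → ℝ, Y → ℝ) →L[ℝ] C(X → ℝ, Y → ℝ) where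
  toFun f := (Fintype.card G : ℝ)⁻¹ • ∑ g : G,
    (⟨permRep G Y g, continuous_permRep g⟩ : C(Y → ℝ, Y → ℝ)).comp
      (f.comp ⟨cosetAverage H g, continuous_cosetAverage H g⟩)
  map_add' f f' := by
    ext v y
    simp [Finset.sum_add_distrib, mul_add]
  map_smul' c f := by
    ext v y
    simp [Finset.mul_sum, mul_left_comm]
  cont := (continuous_finsetSum _ fun _ _ => (ContinuousMap.continuous_postcomp _).comp
    (ContinuousMap.continuous_precomp _)).fun_const_smul _

theorem reynolds_apply (f : C(X → ℝ, Y → ℝ)) (v : X → ℝ) :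
    reynolds H f v =
      (Fintype.card G : ℝ)⁻¹ • ∑ g : G, permRep G Y g (f (cosetAverage H g v)) := by
  simp [reynolds]

variable {H} in
theorem reynolds_eq_self {f : C(X → ℝ, Y → ℝ)} (hf : f ∈ continuousEquivariant G X Y)
    (hH : ∀ v, f (average X H v) = f v) : reynolds H f = f := by
  ext1 v
  have conj_eq (g : G) : permRep G Y g (f (cosetAverage H g v)) = f v := by
    rw [cosetAverage_mk, hH, ← hf, permRep_permRep, mul_inv_cancel, map_one, Module.End.one_apply]
  simp [reynolds_apply, conj_eq, ← Nat.cast_smul_eq_nsmul ℝ]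

theorem reynolds_singleCoord_mem_networks [DecidableEq Y] (σ : C(ℝ, ℝ)) {w : C(X → ℝ, ℝ)}
    {a : (X → ℝ) →ᵃ[ℝ] ℝ} (ha : ⇑w = a) (y : Y) :
    reynolds H (singleCoord _ y (σ.comp w)) ∈
      networks σ (affEquiv G X (G ⧸ H)) (affEquiv G (G ⧸ H) Y) := by
  refine Submodule.subset_span ⟨cosetLayer H a, cosetLayer_mem H a,
    (Fintype.card G : ℝ)⁻¹ • (cosetLift H y).toAffineMap,
    Submodule.smul_mem _ _ (cosetLift_mem H y), funext fun v => ?_⟩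
  have permRep_single_smul (g : G) (t : ℝ) :
      permRep G Y g (Pi.single y t) = t • (Pi.single (g • y) 1 : Y → ℝ) := by
    rw [← permRep_single, ← map_smul, ← Pi.single_smul, smul_eq_mul, mul_one]
  change reynolds H _ v = _
  simp [reynolds_apply, permRep_single_smul, cosetLift_apply, pointwise, cosetLayer_apply, ha]

theorem reynolds_mem_fullUniversalityClass {σ : C(ℝ, ℝ)}
    (hσ_poly : ¬ ∃ p : Polynomial ℝ, ∀ t, σ t = p.eval t) (f : C(X → ℝ, Y → ℝ)) :
    reynolds H f ∈ fullUniversalityClass G X (G ⧸ H) Y σ := by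
  classical
  rw [fullUniversalityClass, universalityClass_eq_closure_networks,
    ← Submodule.topologicalClosure_coe]
  set S := (networks σ (affEquiv G X (G ⧸ H)) (affEquiv G (G ⧸ H) Y)).topologicalClosure
  have comap_eq_top : S.comap (reynolds H).toLinearMap = ⊤ := by
    refine eq_top_of_singleCoord_ridge_mem
      ((Submodule.isClosed_topologicalClosure _).preimage (reynolds H).continuous) hσ_poly
      (separatesPoints_affineFunctions X) fun y u ⟨a, ha⟩ b => ?_
    exact Submodule.le_topologicalClosure _ <| reynolds_singleCoord_mem_networks H σ
      (a := a + AffineMap.const ℝ _ b) (by simp [ha]) y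
  exact comap_eq_top.ge (Submodule.mem_top (x := f))

end Reynolds

end Equivariant

section SeparationConstrained

variable {A B : Type*} [TopologicalSpace A] [TopologicalSpace B] {K N : Set C(A, B)}

theorem isSeparationConstrainedUniversal_of_isClosed (hN : IsClosed N) (hNK : N ⊆ K)
    (h : ∀ f ∈ K, (∀ p ∈ separationRel N, f p.1 = f p.2) → f ∈ N) :
    IsSeparationConstrainedUniversal K N :=
  hN.closure_eq.trans <| Set.Subset.antisymm (fun f hf => ⟨hNK hf, fun _ hp => hp f hf⟩)
    fun f hf => h f hf.1 hf.2

theorem IsSeparationConstrainedUniversal.univ (hK : IsSeparationConstrainedUniversal K N)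
    (h : ∀ f : C(A, B), (∀ p ∈ separationRel N, f p.1 = f p.2) → f ∈ K) :
    IsSeparationConstrainedUniversal Set.univ N :=
  hK.trans <| Set.ext fun f => ⟨fun hf => ⟨trivial, hf.2⟩, fun hf => ⟨h f hf.2, hf.2⟩⟩

end SeparationConstrained

theorem mainTheorem5_general {G : Type*} [Group G] [Finite G] (H : Subgroup G) [H.Normal]
    {X Y : Type*} [MulAction G X] [MulAction G Y]
    (σ : ℝ → ℝ) (hσ : Continuous σ) (hσ_poly : ¬ ∃ p : Polynomial ℝ, ∀ t : ℝ, σ t = p.eval t) :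
    IsSeparationConstrainedUniversal (continuousEquivariant G X Y)
        (fullUniversalityClass G X (G ⧸ H) Y σ) ∧
      ((∀ (g : G) (y : Y), g • y = y) →
        IsSeparationConstrainedUniversal Set.univ (fullUniversalityClass G X (G ⧸ H) Y σ)) := by
  have := Fintype.ofFinite G
  have := Fintype.ofFinite H
  have subset_equivariant :=
    fullUniversalityClass_subset_continuousEquivariant (G := G) (X := X) (Y := G ⧸ H) (Z := Y) σ
  have universal : IsSeparationConstrainedUniversal (continuousEquivariant G X Y)
      (fullUniversalityClass G X (G ⧸ H) Y σ) := by
    refine isSeparationConstrainedUniversal_of_isClosed isClosed_closure subset_equivariant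
      fun f hf f_respects => ?_
    have f_average (v : X → ℝ) : f (average X H v) = f v :=
      f_respects (average X H v, v) fun F hF => fullUniversalityClass_average H hF v
    rw [← reynolds_eq_self hf f_average]
    exact reynolds_mem_fullUniversalityClass H (σ := ⟨σ, hσ⟩) hσ_poly f
  exact ⟨universal, fun htriv => universal.univ fun _ f_respects =>
    mem_continuousEquivariant_of_smul_eq subset_equivariant htriv f_respects⟩

end EquivNet

theorem mainTheorem5 {G : Type*} [Group G] [Finite G] (H : Subgroup G) [H.Normal]
    {X Y : Type*} [Finite X] [Finite Y] [MulAction G X] [MulAction G Y]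
    (σ : ℝ → ℝ) (hσ : Continuous σ) (hσ_poly : ¬ ∃ p : Polynomial ℝ, ∀ t : ℝ, σ t = p.eval t) :
    EquivNet.IsSeparationConstrainedUniversal (EquivNet.continuousEquivariant G X Y)
        (EquivNet.fullUniversalityClass G X (G ⧸ H) Y σ) ∧
      ((∀ (g : G) (y : Y), g • y = y) →
        EquivNet.IsSeparationConstrainedUniversal Set.univ
          (EquivNet.fullUniversalityClass G X (G ⧸ H) Y σ)) :=
  EquivNet.mainTheorem5_general H σ hσ hσ_poly
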